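/- **Generalised probabilistic theories.** A GPT consists of a symmetric monoidal category of systems $A,B,\dots$ (trivial system $I$) in which every hom-set $V_A^B$ (from $A$ to $B$) is a finite-dimensional real vector space and composition and tensor product are bilinear, together with closed convex cones $K_A^B\subseteq V_A^B$ of (physical) *processes* such that: * each $K_A^B$ spans $V_A^B$; processes are closed under sequential and parallel composition and contain the identities, the swaps and the coherence isomorphisms; * $V_I^I\cong\mathbb R$ with $\mathrm{id}_I\mapsto 1$ and $K_I^I\mapsto\mathbb R_{\ge 0}$ (numbers); * every system $A$ has a discarding effect $d_A$ in the interior of the effect cone $K_A:=K_A^I$, with $d_{A\otimes B}=d_A\otimes d_B$ and $d_I=1$; * (tomography) processes $f,g:A\to B$ are equal if $e\circ(f\otimes \mathrm{id}_D)\circ s=e\circ(g\otimes \mathrm{id}_D)\circ s$ for all systems $D$, all states $s\in K^{A\otimes D}:=K_I^{A\otimes D}$ and all effects $e\in K_{B\otimes D}$. Write $f\le g$ if $g-f$ is a process. A process $f:A\to B$ is *causal* if $d_B\circ f=d_A$ and *subcausal* if $d_B\circ f\le d_A$. **Money.** A *bank strategy* on a system $A$ is a finite family $\mathcal S_A=\{(p_i,s_i,e_i)\}_i$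 with $p_i>0$, $\sum_i p_i=1$, causal states $s_i$ of $A$, and effects $e_i\in K_A$ with $e_i\le d_A$ and $e_i\circ s_i=1$. It is *spanning* if the $s_i$ span $V^A:=V_I^A$. Its counterfeiting success is $$\alpha(\mathcal S_A)=\sup\Big\{\sum_i p_i\,(e_i\otimes e_i)\circ\chi\circ s_i\;:\;\chi\in K_A^{A\otimes A}\text{ subcausal}\Big\}.$$ The product of two strategies $\{(p_i,s_i,e_i)\}_i$ on $A$ and $\{(q_j,t_j,f_j)\}_j$ on $B$ is the strategy $\{(p_iq_j,\,s_i\otimes t_j,\,e_i\otimes f_j)\}_{i,j}$ on $A\otimes B$; $\mathcal S^{\otimes n}$ denotes the $n$-fold independent repetition of $\mathcal S$ obtained in this way. Call $\mathcal S$ *exponentially secure* if there is $r\in(0,1)$ with $\alpha(\mathcal S^{\otimes n})\le r^n$ for all $n\ge 0$. The theory satisfies **WNC** if some bank strategy has $\alpha<1$, and **SNC** if for every $\delta>0$ some bank strategy has $\alpha\le\delta$. **Theorem.** In every GPT: 1. WNC holds if and only if SNC holds. 2. If some bank strategy on a system $A$ has $\alpha<1$, then there is a spanning bank strategy $\mathcal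 S$ on $A$ with $\alpha(\mathcal S)<1$ that is exponentially secure; in particular, for every $\delta>0$ there is $n\ge1$ with $\alpha(\mathcal S^{\otimes n})\le\delta$. 3. Exactly one of the following holds: (a) perfect counterfeiting: every bank strategy has $\alpha=1$, attained by some subcausal $\chi$; (b) there is an exponentially secure spanning bank strategy. -/

import Mathlib

open CategoryTheory MonoidalCategory

universe v u

/-- A generalised probabilistic theory. The objects of `C` are the systems, `⊗` is parallel
composition, and the hom-space `A ⟶ B` is the real vector space `V_A^B`. The physical processes
from `A` to `B` are the elements of `cone A B`, which is the cone `K_A^B`. States of `A` are the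
processes `𝟙_ C ⟶ A`, effects on `A` are the processes `A ⟶ 𝟙_ C`, and numbers are the processes
`𝟙_ C ⟶ 𝟙_ C`. The finite-dimensional spaces `A ⟶ B` carry their canonical (module) topology. -/
structure GPT (C : Type u) [Category.{v} C] [MonoidalCategory C] [SymmetricCategory C]
    [Preadditive C] [Linear ℝ C] [MonoidalPreadditive C] [MonoidalLinear ℝ C] where
  /-- The convex cone of processes from `A` to `B`. -/
  cone : ∀ A B : C, PointedCone ℝ (A ⟶ B)
  finiteDimensional : ∀ A B : C, FiniteDimensional ℝ (A ⟶ B)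
  span_cone : ∀ A B : C, Submodule.span ℝ (cone A B : Set (A ⟶ B)) = ⊤
  isClosed_cone : ∀ A B : C, @IsClosed (A ⟶ B) (moduleTopology ℝ (A ⟶ B)) (cone A B)
  /- Processes are closed under being wired together. -/
  id_mem : ∀ A : C, 𝟙 A ∈ cone A A
  comp_mem : ∀ {X Y Z : C} {f : X ⟶ Y} {g : Y ⟶ Z},
    f ∈ cone X Y → g ∈ cone Y Z → f ≫ g ∈ cone X Z
  tensor_mem : ∀ {X Y Z W : C} {f : X ⟶ Y} {g : Z ⟶ W},
    f ∈ cone X Y → g ∈ cone Z W → (f ⊗ₘ g) ∈ cone (X ⊗ Z) (Y ⊗ W)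
  associator_hom_mem : ∀ X Y Z : C, (α_ X Y Z).hom ∈ cone ((X ⊗ Y) ⊗ Z) (X ⊗ (Y ⊗ Z))
  associator_inv_mem : ∀ X Y Z : C, (α_ X Y Z).inv ∈ cone (X ⊗ (Y ⊗ Z)) ((X ⊗ Y) ⊗ Z)
  leftUnitor_hom_mem : ∀ X : C, (λ_ X).hom ∈ cone (𝟙_ C ⊗ X) X
  leftUnitor_inv_mem : ∀ X : C, (λ_ X).inv ∈ cone X (𝟙_ C ⊗ X)
  rightUnitor_hom_mem : ∀ X : C, (ρ_ X).hom ∈ cone (X ⊗ 𝟙_ C) X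
  rightUnitor_inv_mem : ∀ X : C, (ρ_ X).inv ∈ cone X (X ⊗ 𝟙_ C)
  braiding_mem : ∀ X Y : C, (β_ X Y).hom ∈ cone (X ⊗ Y) (Y ⊗ X)
  /-- The numbers of the theory are the non-negative reals. -/
  num : (𝟙_ C ⟶ 𝟙_ C) ≃ₗ[ℝ] ℝ
  num_id : num (𝟙 (𝟙_ C)) = 1
  mem_cone_num : ∀ r : 𝟙_ C ⟶ 𝟙_ C, r ∈ cone (𝟙_ C) (𝟙_ C) ↔ 0 ≤ num r
  /-- The discarding effects. -/
  disc : ∀ A : C, A ⟶ 𝟙_ C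
  disc_mem_interior : ∀ A : C,
    disc A ∈ @interior (A ⟶ 𝟙_ C) (moduleTopology ℝ (A ⟶ 𝟙_ C)) (cone A (𝟙_ C))
  disc_tensor : ∀ A B : C, disc (A ⊗ B) = (disc A ⊗ₘ disc B) ≫ (λ_ (𝟙_ C)).hom
  disc_unit : disc (𝟙_ C) = 𝟙 (𝟙_ C)
  /-- Tomography: processes that give the same numbers in all situations are equal. -/
  tomography : ∀ {A B : C} {f g : A ⟶ B}, f ∈ cone A B → g ∈ cone A B →
    (∀ (D : C) (s : 𝟙_ C ⟶ A ⊗ D) (e : B ⊗ D ⟶ 𝟙_ C),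
      s ∈ cone (𝟙_ C) (A ⊗ D) → e ∈ cone (B ⊗ D) (𝟙_ C) →
        s ≫ (f ▷ D) ≫ e = s ≫ (g ▷ D) ≫ e) → f = g

namespace GPT

variable {C : Type u} [Category.{v} C] [MonoidalCategory C] [SymmetricCategory C]
  [Preadditive C] [Linear ℝ C] [MonoidalPreadditive C] [MonoidalLinear ℝ C]

/-- The order on processes: `f ≤ g` if `g = f + z` for a physical process `z`. -/
def ProcLE (T : GPT C) {A B : C} (f g : A ⟶ B) : Prop := g - f ∈ T.cone A B

/-- A process is causal if discarding its output amounts to discarding its input. -/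
def Causal (T : GPT C) {A B : C} (f : A ⟶ B) : Prop :=
  f ∈ T.cone A B ∧ f ≫ T.disc B = T.disc A

/-- A process is subcausal if discarding its output is below discarding its input. -/
def Subcausal (T : GPT C) {A B : C} (f : A ⟶ B) : Prop :=
  f ∈ T.cone A B ∧ T.ProcLE (f ≫ T.disc B) (T.disc A)

/-- The parallel composite of two vectors of the state spaces of `A` and `B`. -/
def tensorState {A B : C} (s : 𝟙_ C ⟶ A) (t : 𝟙_ C ⟶ B) : 𝟙_ C ⟶ A ⊗ B :=
  (λ_ (𝟙_ C)).inv ≫ (s ⊗ₘ t)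

/-- The parallel composite of two vectors of the effect spaces of `A` and `B`. -/
def tensorEffect {A B : C} (e : A ⟶ 𝟙_ C) (f : B ⟶ 𝟙_ C) : A ⊗ B ⟶ 𝟙_ C :=
  (e ⊗ₘ f) ≫ (λ_ (𝟙_ C)).hom

/-- A bank strategy on the system `A`: a finite ensemble `(p i, s i)` of causal states with
positive probabilities, and for each of them a subcausal effect `e i` that always accepts `s i`. -/
structure BankStrategy (T : GPT C) (A : C) where
  ι : Type
  fintype : Fintype ι
  p : ι → ℝ
  p_pos : ∀ i, 0 < p i
  p_sum : ∑ i, p i = 1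
  s : ι → (𝟙_ C ⟶ A)
  s_causal : ∀ i, T.Causal (s i)
  e : ι → (A ⟶ 𝟙_ C)
  e_mem : ∀ i, e i ∈ T.cone A (𝟙_ C)
  e_le : ∀ i, T.ProcLE (e i) (T.disc A)
  accepts : ∀ i, T.num (s i ≫ e i) = 1

attribute [instance] BankStrategy.fintype

/-- The physical counterfeiting machines on `A`. -/
def machines (T : GPT C) (A : C) : Set (A ⟶ A ⊗ A) := {χ | T.Subcausal χ}

/-- The probability that both outputs of `χ` pass the bank's independent verifications. -/
def success (T : GPT C) {A : C} (S : BankStrategy T A) (χ : A ⟶ A ⊗ A) : ℝ :=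
  ∑ i, S.p i * T.num (S.s i ≫ χ ≫ tensorEffect (S.e i) (S.e i))

/-- The optimal success probability of a counterfeiter against `S`. -/
noncomputable def alpha (T : GPT C) {A : C} (S : BankStrategy T A) : ℝ :=
  sSup (T.success S '' T.machines A)

/-- A bank strategy is spanning if its states span the state space of its system. -/
def Spanning (T : GPT C) {A : C} (S : BankStrategy T A) : Prop :=
  Submodule.span ℝ (Set.range S.s) = ⊤

/-- Weak no-counterfeiting. -/
def WNC (T : GPT C) : Prop := ∃ (A : C) (S : BankStrategy T A), T.alpha S < 1

/-- Strong no-counterfeiting. -/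
def SNC (T : GPT C) : Prop :=
  ∀ δ : ℝ, 0 < δ → ∃ (A : C) (S : BankStrategy T A), T.alpha S ≤ δ

/-- Every bank strategy can be counterfeited perfectly. -/
def PerfectCounterfeiting (T : GPT C) : Prop :=
  ∀ (A : C) (S : BankStrategy T A),
    T.alpha S = 1 ∧ ∃ χ ∈ T.machines A, T.success S χ = 1

theorem disc_mem (T : GPT C) (A : C) : T.disc A ∈ T.cone A (𝟙_ C) :=
  @interior_subset (A ⟶ 𝟙_ C) (moduleTopology ℝ (A ⟶ 𝟙_ C)) _ _ (T.disc_mem_interior A)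

set_option linter.unusedSectionVars false in
theorem tensorState_comp_tensorEffect {A B : C} (s : 𝟙_ C ⟶ A) (t : 𝟙_ C ⟶ B)
    (e : A ⟶ 𝟙_ C) (f : B ⟶ 𝟙_ C) :
    tensorState s t ≫ tensorEffect e f = (s ≫ e) ≫ (t ≫ f) := by
  simp only [tensorState, tensorEffect, Category.assoc]
  rw [← Category.assoc (s ⊗ₘ t), tensorHom_comp_tensorHom, MonoidalCategory.tensorHom_def,
    unitors_equal]
  simp [← unitors_inv_equal, ← unitors_equal]

theorem num_comp (T : GPT C) (r q : 𝟙_ C ⟶ 𝟙_ C) : T.num (r ≫ q) = T.num r * T.num q := by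
  have h : r = T.num r • 𝟙 (𝟙_ C) := T.num.injective (by simp [T.num_id])
  conv_lhs => rw [h]
  simp

/-- The product strategy: one state is sampled from each of the strategies independently. -/
def BankStrategy.prod {T : GPT C} {A B : C} (S : BankStrategy T A) (S' : BankStrategy T B) :
    BankStrategy T (A ⊗ B) where
  ι := S.ι × S'.ι
  fintype := inferInstance
  p k := S.p k.1 * S'.p k.2
  p_pos k := mul_pos (S.p_pos _) (S'.p_pos _)
  p_sum := by
    rw [Fintype.sum_prod_type]
    simp only [← Finset.mul_sum, S'.p_sum, mul_one, S.p_sum]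
  s k := tensorState (S.s k.1) (S'.s k.2)
  s_causal k := by
    refine ⟨T.comp_mem (T.leftUnitor_inv_mem _)
      (T.tensor_mem (S.s_causal _).1 (S'.s_causal _).1), ?_⟩
    have h := tensorState_comp_tensorEffect (S.s k.1) (S'.s k.2) (T.disc A) (T.disc B)
    rw [T.disc_tensor]
    rw [tensorEffect] at h
    rw [h, (S.s_causal _).2, (S'.s_causal _).2, T.disc_unit, Category.comp_id]
  e k := tensorEffect (S.e k.1) (S'.e k.2)
  e_mem k := T.comp_mem (T.tensor_mem (S.e_mem _) (S'.e_mem _)) (T.leftUnitor_hom_mem _)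
  e_le k := by
    have h : T.disc (A ⊗ B) - tensorEffect (S.e k.1) (S'.e k.2) =
        tensorEffect (T.disc A - S.e k.1) (T.disc B)
          + tensorEffect (S.e k.1) (T.disc B - S'.e k.2) := by
      rw [sub_eq_iff_eq_add, T.disc_tensor]
      simp only [tensorEffect, ← Preadditive.add_comp]
      rw [add_assoc, ← MonoidalPreadditive.tensor_add, sub_add_cancel,
        ← MonoidalPreadditive.add_tensor, sub_add_cancel]
    rw [ProcLE, h]
    exact Submodule.add_mem _
      (T.comp_mem (T.tensor_mem (S.e_le _) (T.disc_mem _)) (T.leftUnitor_hom_mem _))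
      (T.comp_mem (T.tensor_mem (S.e_mem _) (S'.e_le _)) (T.leftUnitor_hom_mem _))
  accepts k := by
    rw [tensorState_comp_tensorEffect, T.num_comp, S.accepts, S'.accepts, mul_one]

/-- The strategy on the trivial system with a single state and a single effect, both the
number `1`. -/
def BankStrategy.unit (T : GPT C) : BankStrategy T (𝟙_ C) where
  ι := Unit
  fintype := inferInstance
  p _ := 1
  p_pos _ := one_pos
  p_sum := by simp
  s _ := 𝟙 (𝟙_ C)
  s_causal _ := ⟨T.id_mem _, by simp⟩
  e _ := 𝟙 (𝟙_ C)
  e_mem _ := T.id_mem _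
  e_le _ := by simp [ProcLE, T.disc_unit]
  accepts _ := by simp [T.num_id]

/-- The `n`-fold composite `A ⊗ (A ⊗ ⋯ )` of a system. -/
def systemPow (A : C) : ℕ → C
  | 0 => 𝟙_ C
  | n + 1 => A ⊗ systemPow A n

/-- The `n`-fold independent repetition of a bank strategy. -/
def BankStrategy.rep {T : GPT C} {A : C} (S : BankStrategy T A) :
    (n : ℕ) → BankStrategy T (systemPow A n)
  | 0 => BankStrategy.unit T
  | n + 1 => S.prod (S.rep n)

/-- The optimal counterfeiting probability against the `n`-fold independent repetition of `S`
decays exponentially in `n`. -/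
def ExponentiallySecure (T : GPT C) {A : C} (S : BankStrategy T A) : Prop :=
  ∃ r : ℝ, 0 < r ∧ r < 1 ∧ ∀ n : ℕ, T.alpha (S.rep n) ≤ r ^ n

end GPT

/-! Security of repetitions rests on a multiplicative bound. Suppose a physical state `τ` satisfies:
the success of every process `χ` against `S` is at most the number obtained by feeding `τ` to `χ`
and discarding both outputs. In a machine attacking `S.prod S'`, the `S` input can then be replaced
by `τ` and the `S` verification by discarding. What remains is a machine against `S'`, subcausal up
to the factor `‖τ‖`, the number got by discarding `τ`; so each further copy of `S` costs a factor
`‖τ‖` (`alpha_prod_le`).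

Such a `τ` with `‖τ‖ < 1` comes from conic duality. Riesz extension gives a dominating functional
with value `β < 1` on discarding (`exists_dual`), but nothing makes it a physical state. The average
state of `S` also dominates, with norm `1`, and if `S` is spanning it is a combination of spanning
states with strictly positive weights. Moving slightly from it towards the dual functional keeps the
weights nonnegative and brings the norm below `1` (`Spanning.exists_state_dual`).

Spanning costs little: mixing in causal states that are verified by discarding keeps `alpha` below
`1` (`exists_spanning_alpha_le`). If no strategy has `alpha < 1`, perfect machines exist by
compactness of the set of machines (`exists_success_eq_alpha`). -/

namespace GPT

/-! ### Diagrammatic identities for states and effects -/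

section Wiring

variable {C : Type u} [Category.{v} C] [MonoidalCategory C]

/-- Prepare the state `t` on the second factor. -/
def prepRight (A : C) {B : C} (t : 𝟙_ C ⟶ B) : A ⟶ A ⊗ B := (ρ_ A).inv ≫ A ◁ t

/-- Prepare the state `s` on the first factor. -/
def prepLeft {A : C} (s : 𝟙_ C ⟶ A) (B : C) : B ⟶ A ⊗ B := (λ_ B).inv ≫ s ▷ B

/-- Apply the effect `f` to the second factor. -/
def testRight (A : C) {B : C} (f : B ⟶ 𝟙_ C) : A ⊗ B ⟶ A := A ◁ f ≫ (ρ_ A).hom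

/-- Apply the effect `e` to the first factor. -/
def testLeft {A : C} (e : A ⟶ 𝟙_ C) (B : C) : A ⊗ B ⟶ B := e ▷ B ≫ (λ_ B).hom

theorem comp_prepRight {A B : C} (s : 𝟙_ C ⟶ A) (t : 𝟙_ C ⟶ B) :
    s ≫ prepRight A t = tensorState s t := by
  simp only [prepRight, tensorState, MonoidalCategory.tensorHom_def, unitors_inv_equal]
  rw [rightUnitor_inv_naturality_assoc]

theorem comp_prepLeft {A B : C} (s : 𝟙_ C ⟶ A) (t : 𝟙_ C ⟶ B) :
    t ≫ prepLeft s B = tensorState s t := by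
  simp only [prepLeft, tensorState, MonoidalCategory.tensorHom_def']
  rw [leftUnitor_inv_naturality_assoc]

theorem testRight_comp {A B : C} (e : A ⟶ 𝟙_ C) (f : B ⟶ 𝟙_ C) :
    testRight A f ≫ e = tensorEffect e f := by
  simp only [testRight, tensorEffect, MonoidalCategory.tensorHom_def', unitors_equal, Category.assoc,
    rightUnitor_naturality]

theorem testLeft_comp {A B : C} (e : A ⟶ 𝟙_ C) (f : B ⟶ 𝟙_ C) :
    testLeft e B ≫ f = tensorEffect e f := by
  simp only [testLeft, tensorEffect, MonoidalCategory.tensorHom_def, Category.assoc, leftUnitor_naturality]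

theorem prepLeft_comp_tensorEffect {A B : C} (s : 𝟙_ C ⟶ A) (e : A ⟶ 𝟙_ C) (f : B ⟶ 𝟙_ C) :
    prepLeft s B ≫ tensorEffect e f = (λ_ B).inv ≫ (s ≫ e) ▷ B ≫ (λ_ B).hom ≫ f := by
  simp [prepLeft, tensorEffect, MonoidalCategory.tensorHom_def]

/-- An ancilla is no help in probing an effect: it can be tested first, leaving a state of `A`. This
reduces tomography of effects to states of `A` alone. -/
theorem whiskerRight_comp_effect {A D : C} (e : A ⟶ 𝟙_ C) (h : 𝟙_ C ⊗ D ⟶ 𝟙_ C) :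
    e ▷ D ≫ h = testRight A ((λ_ D).inv ≫ h) ≫ e := by
  rw [testRight_comp, tensorEffect, MonoidalCategory.tensorHom_def, whiskerLeft_comp]
  simp

theorem tensorμ_comp_tensorEffect [BraidedCategory C] {X₁ X₂ Y₁ Y₂ : C} (e₁ : X₁ ⟶ 𝟙_ C)
    (e₂ : X₂ ⟶ 𝟙_ C) (f₁ : Y₁ ⟶ 𝟙_ C) (f₂ : Y₂ ⟶ 𝟙_ C) :
    tensorμ X₁ X₂ Y₁ Y₂ ≫ tensorEffect (tensorEffect e₁ f₁) (tensorEffect e₂ f₂) =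
      tensorEffect (tensorEffect e₁ e₂) (tensorEffect f₁ f₂) := by
  have key : tensorμ (𝟙_ C) (𝟙_ C) (𝟙_ C) (𝟙_ C) ≫ ((λ_ (𝟙_ C)).hom ⊗ₘ (λ_ (𝟙_ C)).hom) =
      ((λ_ (𝟙_ C)).hom ⊗ₘ (λ_ (𝟙_ C)).hom) := by
    -- This exposes the same `tensorμ` on the right, so only unitor coherence remains and the
    -- braiding of the unit is never evaluated.
    conv_rhs => rw [leftUnitor_monoidal]
    congr 1
    monoidal
  simp only [tensorEffect, ← tensorHom_comp_tensorHom, Category.assoc]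
  rw [← tensorμ_natural_assoc, reassoc_of% key]

end Wiring

variable {C : Type u} [Category.{v} C] [MonoidalCategory C] [SymmetricCategory C]
  [Preadditive C] [Linear ℝ C] [MonoidalPreadditive C] [MonoidalLinear ℝ C] (T : GPT C)

/-! ### Closure of the cones under wiring -/

section Cone

variable {T}

theorem whiskerRight_mem {A B : C} {f : A ⟶ B} (hf : f ∈ T.cone A B) (D : C) :
    f ▷ D ∈ T.cone (A ⊗ D) (B ⊗ D) := by
  rw [← tensorHom_id]; exact T.tensor_mem hf (T.id_mem D)

theorem whiskerLeft_mem {A B : C} {f : A ⟶ B} (hf : f ∈ T.cone A B) (D : C) :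
    D ◁ f ∈ T.cone (D ⊗ A) (D ⊗ B) := by
  rw [← id_tensorHom]; exact T.tensor_mem (T.id_mem D) hf

theorem tensorEffect_mem {A B : C} {e : A ⟶ 𝟙_ C} {f : B ⟶ 𝟙_ C} (he : e ∈ T.cone A _)
    (hf : f ∈ T.cone B _) : tensorEffect e f ∈ T.cone (A ⊗ B) (𝟙_ C) :=
  T.comp_mem (T.tensor_mem he hf) (T.leftUnitor_hom_mem _)

theorem prepRight_mem (A : C) {B : C} {t : 𝟙_ C ⟶ B} (ht : t ∈ T.cone _ B) :
    prepRight A t ∈ T.cone A (A ⊗ B) :=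
  T.comp_mem (T.rightUnitor_inv_mem _) (whiskerLeft_mem ht _)

theorem prepLeft_mem {A : C} {s : 𝟙_ C ⟶ A} (hs : s ∈ T.cone _ A) (B : C) :
    prepLeft s B ∈ T.cone B (A ⊗ B) :=
  T.comp_mem (T.leftUnitor_inv_mem _) (whiskerRight_mem hs _)

theorem testRight_mem (A : C) {B : C} {f : B ⟶ 𝟙_ C} (hf : f ∈ T.cone B _) :
    testRight A f ∈ T.cone (A ⊗ B) A :=
  T.comp_mem (whiskerLeft_mem hf _) (T.rightUnitor_hom_mem _)

theorem testLeft_mem {A : C} {e : A ⟶ 𝟙_ C} (he : e ∈ T.cone A _) (B : C) :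
    testLeft e B ∈ T.cone (A ⊗ B) B :=
  T.comp_mem (whiskerRight_mem he _) (T.leftUnitor_hom_mem _)

theorem tensorμ_mem (X₁ X₂ Y₁ Y₂ : C) : tensorμ X₁ X₂ Y₁ Y₂ ∈ T.cone _ _ :=
  T.comp_mem (T.associator_hom_mem _ _ _) <|
    T.comp_mem (whiskerLeft_mem (T.associator_inv_mem _ _ _) _) <|
      T.comp_mem (whiskerLeft_mem (whiskerRight_mem (T.braiding_mem _ _) _) _) <|
        T.comp_mem (whiskerLeft_mem (T.associator_hom_mem _ _ _) _) (T.associator_inv_mem _ _ _)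

end Cone

/-! ### Success probabilities and the product bound -/

/-- The number obtained by sandwiching a process between `s` and `e`, as a linear functional of
the process. -/
def pairing {A B : C} (s : 𝟙_ C ⟶ A) (e : B ⟶ 𝟙_ C) : (A ⟶ B) →ₗ[ℝ] ℝ :=
  T.num.toLinearMap ∘ₗ Linear.leftComp ℝ _ s ∘ₗ Linear.rightComp ℝ _ e

@[simp]
theorem pairing_apply {A B : C} (s : 𝟙_ C ⟶ A) (e : B ⟶ 𝟙_ C) (χ : A ⟶ B) :
    T.pairing s e χ = T.num (s ≫ χ ≫ e) := rfl

/-- The value of a state on effects, as a linear functional, linearly in the state. -/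
def evalState (A : C) : (𝟙_ C ⟶ A) →ₗ[ℝ] (A ⟶ 𝟙_ C) →ₗ[ℝ] ℝ :=
  LinearMap.mk₂ ℝ (fun s e => T.num (s ≫ e)) (by simp) (by simp) (by simp) (by simp)

@[simp]
theorem evalState_apply {A : C} (s : 𝟙_ C ⟶ A) (e : A ⟶ 𝟙_ C) :
    T.evalState A s e = T.num (s ≫ e) := rfl

/-- The success probability as a linear functional of the machine. -/
def successₗ {A : C} (S : BankStrategy T A) : (A ⟶ A ⊗ A) →ₗ[ℝ] ℝ :=
  ∑ i, S.p i • T.pairing (S.s i) (tensorEffect (S.e i) (S.e i))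

theorem successₗ_apply {A : C} (S : BankStrategy T A) (χ : A ⟶ A ⊗ A) :
    T.successₗ S χ = T.success S χ := by
  simp [successₗ, success]

/-- The average state of a bank strategy. -/
def average {A : C} (S : BankStrategy T A) : 𝟙_ C ⟶ A := ∑ i, S.p i • S.s i

variable {T}

theorem num_nonneg {r : 𝟙_ C ⟶ 𝟙_ C} (hr : r ∈ T.cone _ _) : 0 ≤ T.num r :=
  (T.mem_cone_num r).1 hr

theorem num_le_of_procLE {A : C} {e f : A ⟶ 𝟙_ C} (h : T.ProcLE e f) {s : 𝟙_ C ⟶ A}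
    (hs : s ∈ T.cone _ A) : T.num (s ≫ e) ≤ T.num (s ≫ f) := by
  have := num_nonneg (T.comp_mem hs h)
  rwa [Preadditive.comp_sub, map_sub, sub_nonneg] at this

theorem smul_mem_cone {A B : C} {f : A ⟶ B} (hf : f ∈ T.cone A B) {c : ℝ} (hc : 0 ≤ c) :
    c • f ∈ T.cone A B :=
  (T.cone A B).smul_mem hc hf

theorem Causal.num_disc {A : C} {s : 𝟙_ C ⟶ A} (hs : T.Causal s) : T.num (s ≫ T.disc A) = 1 := by
  rw [hs.2, T.disc_unit, T.num_id]

theorem disc_tensor' (A B : C) : T.disc (A ⊗ B) = tensorEffect (T.disc A) (T.disc B) :=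
  T.disc_tensor A B

theorem BankStrategy.tensorEffect_procLE {A : C} (S : BankStrategy T A) (i : S.ι) :
    T.ProcLE (tensorEffect (S.e i) (S.e i)) (T.disc (A ⊗ A)) :=
  (S.prod S).e_le (i, i)

theorem average_mem {A : C} (S : BankStrategy T A) : T.average S ∈ T.cone _ A :=
  Submodule.sum_mem _ fun i _ => smul_mem_cone (S.s_causal i).1 (S.p_pos i).le

theorem num_average_comp {A : C} (S : BankStrategy T A) (e : A ⟶ 𝟙_ C) :
    T.num (T.average S ≫ e) = ∑ i, S.p i * T.num (S.s i ≫ e) := by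
  simp [average, Preadditive.sum_comp]

theorem num_average_disc {A : C} (S : BankStrategy T A) :
    T.num (T.average S ≫ T.disc A) = 1 := by
  simp [num_average_comp, (S.s_causal _).num_disc, S.p_sum]

/-- Each verification is below discarding. Hence the average state is always a dual feasible point,
of value `1`. -/
theorem success_le_average {A : C} (S : BankStrategy T A) {χ : A ⟶ A ⊗ A}
    (hχ : χ ∈ T.cone _ _) :
    T.success S χ ≤ T.num (T.average S ≫ χ ≫ T.disc (A ⊗ A)) := by
  rw [num_average_comp, success]
  refine Finset.sum_le_sum fun i _ => mul_le_mul_of_nonneg_left ?_ (S.p_pos i).le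
  simp only [← Category.assoc]
  exact num_le_of_procLE (S.tensorEffect_procLE i) (T.comp_mem (S.s_causal i).1 hχ)

theorem success_nonneg {A : C} (S : BankStrategy T A) {χ : A ⟶ A ⊗ A}
    (hχ : χ ∈ T.cone _ _) : 0 ≤ T.success S χ :=
  Finset.sum_nonneg fun i _ => mul_nonneg (S.p_pos i).le <| num_nonneg <|
    T.comp_mem (S.s_causal i).1 <| T.comp_mem hχ <| tensorEffect_mem (S.e_mem i) (S.e_mem i)

theorem success_le_one {A : C} (S : BankStrategy T A) {χ : A ⟶ A ⊗ A}
    (hχ : T.Subcausal χ) : T.success S χ ≤ 1 :=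
  (success_le_average S hχ.1).trans <|
    (num_le_of_procLE hχ.2 (average_mem S)).trans_eq (num_average_disc S)

theorem zero_mem_machines (A : C) : (0 : A ⟶ A ⊗ A) ∈ T.machines A :=
  ⟨Submodule.zero_mem _, by simpa [ProcLE] using T.disc_mem A⟩

theorem bddAbove_success {A : C} (S : BankStrategy T A) :
    BddAbove (T.success S '' T.machines A) := by
  refine ⟨1, ?_⟩
  rintro _ ⟨χ, hχ, rfl⟩
  exact success_le_one S hχ

theorem success_le_alpha {A : C} (S : BankStrategy T A) {χ : A ⟶ A ⊗ A}
    (hχ : T.Subcausal χ) : T.success S χ ≤ T.alpha S :=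
  le_csSup (bddAbove_success S) ⟨χ, hχ, rfl⟩

theorem alpha_le {A : C} (S : BankStrategy T A) {c : ℝ}
    (h : ∀ χ, T.Subcausal χ → T.success S χ ≤ c) : T.alpha S ≤ c := by
  refine csSup_le ⟨_, 0, zero_mem_machines A, rfl⟩ ?_
  rintro _ ⟨χ, hχ, rfl⟩
  exact h χ hχ

theorem alpha_le_one {A : C} (S : BankStrategy T A) : T.alpha S ≤ 1 :=
  alpha_le S fun _ => success_le_one S

/-- A machine whose output effect is bounded by a multiple of discarding succeeds at most with
that multiple of the optimal probability. -/
theorem success_le_mul_alpha {A : C} (S : BankStrategy T A) {χ : A ⟶ A ⊗ A} {c : ℝ} (hc : 0 < c)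
    (hχ : χ ∈ T.cone _ _) (h : T.ProcLE (χ ≫ T.disc (A ⊗ A)) (c • T.disc A)) :
    T.success S χ ≤ c * T.alpha S := by
  have h1 := success_le_alpha S (χ := c⁻¹ • χ)
    ⟨smul_mem_cone hχ (inv_nonneg.2 hc.le), by
      have := smul_mem_cone h (inv_nonneg.2 hc.le)
      rwa [smul_sub, inv_smul_smul₀ hc.ne', ← Linear.smul_comp] at this⟩
  rw [← successₗ_apply, map_smul, successₗ_apply, smul_eq_mul, inv_mul_le_iff₀ hc] at h1
  exact h1

/-- If the success probability against `S` is dominated by the output effect in a physical state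
`τ`, then adding an independent copy of `S` lowers the optimal success probability by the factor
given by the norm of `τ`. -/
theorem alpha_prod_le {A B : C} (S : BankStrategy T A) (S' : BankStrategy T B) {τ : 𝟙_ C ⟶ A}
    (hτ : τ ∈ T.cone _ A) (hpos : 0 < T.num (τ ≫ T.disc A))
    (hdom : ∀ χ ∈ T.cone A (A ⊗ A), T.success S χ ≤ T.num (τ ≫ χ ≫ T.disc (A ⊗ A))) :
    T.alpha (S.prod S') ≤ T.num (τ ≫ T.disc A) * T.alpha S' := by
  refine alpha_le _ fun χ hχ => ?_
  -- The induced attack on `S'`: feed `τ` into the `A` input of `χ` and discard both `A` outputs.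
  set ψ : B ⟶ B ⊗ B := prepLeft τ B ≫ χ ≫ tensorμ A B A B ≫ testLeft (T.disc (A ⊗ A)) (B ⊗ B)
    with hψ
  have hψmem : ψ ∈ T.cone _ _ := T.comp_mem (prepLeft_mem hτ _) <| T.comp_mem hχ.1 <|
    T.comp_mem (tensorμ_mem _ _ _ _) (testLeft_mem (T.disc_mem _) _)
  have hsub : T.ProcLE (ψ ≫ T.disc (B ⊗ B)) (T.num (τ ≫ T.disc A) • T.disc B) := by
    have h1 := T.comp_mem (prepLeft_mem hτ B) hχ.2
    have h2 : prepLeft τ B ≫ T.disc (A ⊗ B) = T.num (τ ≫ T.disc A) • T.disc B := by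
      have h : τ ≫ T.disc A = T.num (τ ≫ T.disc A) • 𝟙 (𝟙_ C) :=
        T.num.injective (by simp [T.num_id])
      rw [disc_tensor', prepLeft_comp_tensorEffect, h]
      simp [T.num_id]
    rw [Preadditive.comp_sub, h2] at h1
    rw [ProcLE, hψ]
    convert h1 using 2
    simp only [Category.assoc, testLeft_comp, disc_tensor', tensorμ_comp_tensorEffect]
  refine le_trans ?_ (success_le_mul_alpha S' hpos hψmem hsub)
  have hcomp : ∀ j, ∑ i, S.p i * T.num (tensorState (S.s i) (S'.s j) ≫ χ ≫
      tensorEffect (tensorEffect (S.e i) (S'.e j)) (tensorEffect (S.e i) (S'.e j))) ≤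
      T.num (S'.s j ≫ ψ ≫ tensorEffect (S'.e j) (S'.e j)) := by
    intro j
    -- For fixed `j`, preparing the `B` input and testing both `B` outputs turns `χ` into a process
    -- on `A`, to which domination by `τ` applies.
    have h1 := hdom (prepRight A (S'.s j) ≫ χ ≫ tensorμ A B A B ≫
      testRight (A ⊗ A) (tensorEffect (S'.e j) (S'.e j)))
      (T.comp_mem (prepRight_mem _ (S'.s_causal j).1) <| T.comp_mem hχ.1 <|
        T.comp_mem (tensorμ_mem _ _ _ _) (testRight_mem _ (tensorEffect_mem (S'.e_mem j)
          (S'.e_mem j))))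
    simp only [success, Category.assoc, testRight_comp] at h1
    simp only [hψ, Category.assoc, testLeft_comp]
    rw [← Category.assoc _ (prepLeft τ B), comp_prepLeft]
    rw [← Category.assoc _ (prepRight _ _), comp_prepRight] at h1
    refine le_trans (le_of_eq ?_) h1
    refine Finset.sum_congr rfl fun i _ => ?_
    rw [← Category.assoc _ (prepRight _ _), comp_prepRight, tensorμ_comp_tensorEffect]
  calc T.success (S.prod S') χ = ∑ j, S'.p j * ∑ i, S.p i *
        T.num (tensorState (S.s i) (S'.s j) ≫ χ ≫
      tensorEffect (tensorEffect (S.e i) (S'.e j)) (tensorEffect (S.e i) (S'.e j))) := by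
        change ∑ k : S.ι × S'.ι, S.p k.1 * S'.p k.2 * _ = _
        rw [Fintype.sum_prod_type_right]
        refine Finset.sum_congr rfl fun j _ => ?_
        rw [Finset.mul_sum]
        refine Finset.sum_congr rfl fun i _ => ?_
        rw [mul_comm (S.p i), mul_assoc]
        rfl
    _ ≤ T.success S' ψ :=
        Finset.sum_le_sum fun j _ => mul_le_mul_of_nonneg_left (hcomp j) (S'.p_pos j).le

end GPT

/-! ### Closed cones in finite dimension -/

/-- A linear functional that is strictly positive on a closed cone in a finite-dimensional normed
space bounds the norm on that cone. -/
theorem PointedCone.exists_norm_le_mul {E : Type*} [NormedAddCommGroup E] [NormedSpace ℝ E]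
    [FiniteDimensional ℝ E] (K : PointedCone ℝ E) (hK : IsClosed (K : Set E)) (l : E →ₗ[ℝ] ℝ)
    (hl : ∀ x ∈ K, x ≠ 0 → 0 < l x) : ∃ M : ℝ, 0 ≤ M ∧ ∀ x ∈ K, ‖x‖ ≤ M * l x := by
  have hcomp : IsCompact ((K : Set E) ∩ Metric.sphere 0 1) :=
    (isCompact_sphere (0 : E) 1).inter_left hK
  rcases ((K : Set E) ∩ Metric.sphere 0 1).eq_empty_or_nonempty with hne | hne
  · refine ⟨0, le_rfl, fun x hx => ?_⟩
    rcases eq_or_ne x 0 with rfl | h0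
    · simp
    · have hx1 : ‖x‖⁻¹ • x ∈ (K : Set E) ∩ Metric.sphere 0 1 :=
        ⟨K.smul_mem (inv_nonneg.2 (norm_nonneg x)) hx, by simp [norm_smul, h0]⟩
      rw [hne] at hx1
      exact hx1.elim
  -- The constant is the inverse of the minimum of `l` on the unit-norm slice of the cone.
  · obtain ⟨y, hy, hmin⟩ :=
      hcomp.exists_isMinOn hne (LinearMap.continuous_of_finiteDimensional l).continuousOn
    have hy0 : y ≠ 0 := by
      rintro rfl
      simpa using hy.2
    have hly := hl y hy.1 hy0
    refine ⟨(l y)⁻¹, (inv_pos.2 hly).le, fun x hx => ?_⟩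
    rcases eq_or_ne x 0 with rfl | h0
    · simp
    · have hx1 : ‖x‖⁻¹ • x ∈ (K : Set E) ∩ Metric.sphere 0 1 :=
        ⟨K.smul_mem (inv_nonneg.2 (norm_nonneg x)) hx, by simp [norm_smul, h0]⟩
      have h1 : l y ≤ l (‖x‖⁻¹ • x) := hmin hx1
      rw [map_smul, smul_eq_mul, le_inv_mul_iff₀ (norm_pos_iff.2 h0)] at h1
      rw [le_inv_mul_iff₀ hly, mul_comm]
      exact h1

/-- A linear functional attains its maximum over the part of a closed cone on which a strictly
positive functional is bounded and which is cut out by a closed condition. The topologies are the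
canonical ones of finite-dimensional spaces. -/
theorem PointedCone.exists_forall_le_of_pos {E F : Type*} [AddCommGroup E] [Module ℝ E]
    [FiniteDimensional ℝ E] [AddCommGroup F] [Module ℝ F] (K : PointedCone ℝ E)
    (hK : @IsClosed E (moduleTopology ℝ E) K) (l : E →ₗ[ℝ] ℝ) (hl : ∀ x ∈ K, x ≠ 0 → 0 < l x)
    (K' : Set F) (hK' : @IsClosed F (moduleTopology ℝ F) K') (L : E →ₗ[ℝ] F) (v : F)
    (hv : v ∈ K') (c : ℝ) (hc : ∀ x ∈ K, v - L x ∈ K' → l x ≤ c) (w : E →ₗ[ℝ] ℝ) :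
    ∃ x ∈ K, v - L x ∈ K' ∧ ∀ y ∈ K, v - L y ∈ K' → w y ≤ w x := by
  -- `E` carries no norm, so the compactness argument is run in coordinates.
  let φ : E ≃ₗ[ℝ] (Fin (Module.finrank ℝ E) → ℝ) := (Module.finBasis ℝ E).equivFun
  let KK : PointedCone ℝ (Fin (Module.finrank ℝ E) → ℝ) := PointedCone.comap φ.symm.toLinearMap K
  let tE : TopologicalSpace E := moduleTopology ℝ E
  let tF : TopologicalSpace F := moduleTopology ℝ F
  have : IsModuleTopology ℝ E := ⟨rfl⟩
  have : IsModuleTopology ℝ F := ⟨rfl⟩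
  have : ContinuousAdd E := IsModuleTopology.toContinuousAdd ℝ E
  have : ContinuousAdd F := IsModuleTopology.toContinuousAdd ℝ F
  have : IsTopologicalAddGroup F := IsModuleTopology.topologicalAddGroup ℝ F
  have hφ : Continuous φ.symm := IsModuleTopology.continuous_of_linearMap φ.symm.toLinearMap
  have hL : Continuous L := IsModuleTopology.continuous_of_linearMap L
  have hw : Continuous w := IsModuleTopology.continuous_of_linearMap w
  have hKK : IsClosed (KK : Set (Fin (Module.finrank ℝ E) → ℝ)) := hK.preimage hφ
  obtain ⟨M, hM0, hM⟩ := KK.exists_norm_le_mul hKK (l ∘ₗ φ.symm.toLinearMap)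
    fun x hx h0 => hl _ hx (by simpa using h0)
  have hcl : IsClosed ({x | v - L (φ.symm x) ∈ K'} : Set (Fin (Module.finrank ℝ E) → ℝ)) :=
    hK'.preimage (continuous_const.sub (hL.comp hφ))
  have hcpt : IsCompact ((KK : Set (Fin (Module.finrank ℝ E) → ℝ)) ∩
      {x | v - L (φ.symm x) ∈ K'}) := by
    refine Metric.isCompact_of_isClosed_isBounded (hKK.inter hcl) ?_
    refine (Metric.isBounded_closedBall (x := 0) (r := M * c)).subset fun x hx => ?_
    rw [mem_closedBall_zero_iff]
    exact (hM x hx.1).trans (mul_le_mul_of_nonneg_left (hc _ hx.1 hx.2) hM0)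
  obtain ⟨x, hx, hmax⟩ := hcpt.exists_isMaxOn ⟨0, KK.zero_mem, by simpa using hv⟩
    (hw.comp hφ).continuousOn
  refine ⟨φ.symm x, hx.1, hx.2, fun y hy hy' => ?_⟩
  have := hmax (show φ y ∈ (KK : Set (Fin (Module.finrank ℝ E) → ℝ)) ∩
      {x | v - L (φ.symm x) ∈ K'} from
    ⟨show φ.symm (φ y) ∈ K by simpa using hy, by simpa using hy'⟩)
  simpa using this

/-- An interior point of a cone is an order unit. -/
theorem PointedCone.exists_smul_add_mem {E : Type*} [AddCommGroup E] [Module ℝ E]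
    (K : PointedCone ℝ E) {d : E} (hd : d ∈ @interior E (moduleTopology ℝ E) K) (e : E) :
    ∃ c : ℝ, 0 < c ∧ c • d + e ∈ K := by
  let tE : TopologicalSpace E := moduleTopology ℝ E
  have : IsModuleTopology ℝ E := ⟨rfl⟩
  have : ContinuousAdd E := IsModuleTopology.toContinuousAdd ℝ E
  have hcont : Continuous fun t : ℝ => d + t • e := by fun_prop
  have h0 : ∀ᶠ t : ℝ in nhds 0, d + t • e ∈ K :=
    hcont.continuousAt (x := 0) (by simpa using mem_interior_iff_mem_nhds.1 hd)
  obtain ⟨ε, hε, h⟩ := Metric.eventually_nhds_iff.1 h0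
  have h1 : d + (ε / 2) • e ∈ K := h (by simp [abs_of_pos hε, hε])
  refine ⟨(ε / 2)⁻¹, by positivity, ?_⟩
  have := K.smul_mem (inv_nonneg.2 (half_pos hε).le) h1
  rwa [smul_add, inv_smul_smul₀ (half_pos hε).ne'] at this

/-! ### Separation by states, and attainment of the optimum -/

namespace GPT

variable {C : Type u} [Category.{v} C] [MonoidalCategory C] [SymmetricCategory C]
  [Preadditive C] [Linear ℝ C] [MonoidalPreadditive C] [MonoidalLinear ℝ C] {T : GPT C}

theorem exists_procLE_smul_disc {A : C} (e : A ⟶ 𝟙_ C) :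
    ∃ c : ℝ, 0 < c ∧ T.ProcLE e (c • T.disc A) := by
  obtain ⟨c, hc, h⟩ := (T.cone A (𝟙_ C)).exists_smul_add_mem (T.disc_mem_interior A) (-e)
  exact ⟨c, hc, by rwa [ProcLE, sub_eq_add_neg]⟩

/-- The cone of processes is generating: every vector is a difference of processes. -/
theorem exists_sub_eq {A B : C} (f : A ⟶ B) :
    ∃ g ∈ T.cone A B, ∃ h ∈ T.cone A B, f = g - h := by
  have hf : f ∈ Submodule.span ℝ (T.cone A B : Set (A ⟶ B)) := by
    rw [T.span_cone]; trivial
  induction hf using Submodule.span_induction with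
  | mem x hx => exact ⟨x, hx, 0, zero_mem _, by simp⟩
  | zero => exact ⟨0, zero_mem _, 0, zero_mem _, by simp⟩
  | add x y _ _ hx hy =>
    obtain ⟨g, hg, h, hh, rfl⟩ := hx
    obtain ⟨g', hg', h', hh', rfl⟩ := hy
    exact ⟨_, add_mem hg hg', _, add_mem hh hh', by abel⟩
  | smul a x _ hx =>
    obtain ⟨g, hg, h, hh, rfl⟩ := hx
    rcases le_total 0 a with ha | ha
    · exact ⟨_, smul_mem_cone hg ha, _, smul_mem_cone hh ha, smul_sub _ _ _⟩
    · refine ⟨_, smul_mem_cone hh (neg_nonneg.2 ha), _, smul_mem_cone hg (neg_nonneg.2 ha), ?_⟩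
      rw [smul_sub, neg_smul, neg_smul]; abel

/-- Effects are separated by states. -/
theorem effect_eq_zero {A : C} {e : A ⟶ 𝟙_ C}
    (h : ∀ s ∈ T.cone (𝟙_ C) A, T.num (s ≫ e) = 0) : e = 0 := by
  obtain ⟨g, hg, g', hg', rfl⟩ := exists_sub_eq (T := T) e
  rw [sub_eq_zero]
  refine T.tomography hg hg' fun D s f hs hf => ?_
  simp only [whiskerRight_comp_effect]
  have := h _ (T.comp_mem hs (testRight_mem A (T.comp_mem (T.leftUnitor_inv_mem D) hf)))
  rw [← map_zero T.num] at this
  have := T.num.injective this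
  rwa [Preadditive.comp_sub, sub_eq_zero, Category.assoc, Category.assoc] at this

/-- A process that is never observed by discarding its output vanishes. -/
theorem eq_zero_of_comp_disc {A B : C} {f : A ⟶ B} (hf : f ∈ T.cone A B)
    (h : f ≫ T.disc B = 0) : f = 0 := by
  refine T.tomography hf (zero_mem _) fun D s e hs he => T.num.injective ?_
  -- Discarding is an order unit, so every observed number is squeezed between `0` and a multiple of
  -- the vanishing one.
  obtain ⟨c, -, hle⟩ := exists_procLE_smul_disc (T := T) e
  have hmem := T.comp_mem hs (whiskerRight_mem hf D)
  have h1 := num_le_of_procLE hle hmem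
  have h2 := num_nonneg (T.comp_mem hmem he)
  have h3 : f ▷ D ≫ T.disc (B ⊗ D) = 0 := by
    rw [T.disc_tensor, MonoidalCategory.tensorHom_def, Category.assoc, ← comp_whiskerRight_assoc, h]
    simp
  simp only [Linear.comp_smul, Category.assoc, h3, Limits.comp_zero, smul_zero, map_zero] at h1 h2
  simpa using le_antisymm h1 h2

theorem num_disc_pos {A : C} {s : 𝟙_ C ⟶ A} (hs : s ∈ T.cone _ A) (h0 : s ≠ 0) :
    0 < T.num (s ≫ T.disc A) := by
  refine lt_of_le_of_ne (num_nonneg (T.comp_mem hs (T.disc_mem A))) fun h => h0 ?_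
  exact eq_zero_of_comp_disc hs (T.num.injective (by simpa using h.symm))

/-- The causal states span the state space. -/
theorem span_causal (A : C) : Submodule.span ℝ {s : 𝟙_ C ⟶ A | T.Causal s} = ⊤ := by
  rw [eq_top_iff, ← T.span_cone, Submodule.span_le]
  intro s hs
  rcases eq_or_ne s 0 with rfl | h0
  · exact zero_mem _
  have hpos := num_disc_pos hs h0
  have hc : T.Causal ((T.num (s ≫ T.disc A))⁻¹ • s) := by
    refine ⟨smul_mem_cone hs (inv_nonneg.2 hpos.le), T.num.injective ?_⟩
    simp [T.disc_unit, T.num_id, hpos.ne']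
  rw [← smul_inv_smul₀ hpos.ne' s]
  exact Submodule.smul_mem _ _ (Submodule.subset_span hc)

/-- The states of a spanning strategy separate effects. -/
theorem Spanning.effect_eq_zero {A : C} {S : BankStrategy T A} (hS : T.Spanning S)
    {e : A ⟶ 𝟙_ C} (h : ∀ i, T.num (S.s i ≫ e) = 0) : e = 0 := by
  refine GPT.effect_eq_zero (T := T) fun s _ => ?_
  have hs : s ∈ Submodule.span ℝ (Set.range S.s) := by rw [hS]; trivial
  have hle : Submodule.span ℝ (Set.range S.s) ≤ LinearMap.ker ((T.evalState A).flip e) := by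
    rw [Submodule.span_le]
    rintro _ ⟨i, rfl⟩
    simpa using h i
  simpa using hle hs

/-- The average state of a spanning strategy is strictly positive. -/
theorem Spanning.average_pos {A B : C} {S : BankStrategy T A} (hS : T.Spanning S)
    {χ : A ⟶ B} (hχ : χ ∈ T.cone A B) (h0 : χ ≠ 0) :
    0 < T.num (T.average S ≫ χ ≫ T.disc B) := by
  have hmem := T.comp_mem hχ (T.disc_mem B)
  refine lt_of_le_of_ne (num_nonneg (T.comp_mem (average_mem S) hmem)) fun h => h0 ?_
  refine eq_zero_of_comp_disc hχ (hS.effect_eq_zero fun i => ?_)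
  rw [num_average_comp, eq_comm, Finset.sum_eq_zero_iff_of_nonneg fun i _ =>
    mul_nonneg (S.p_pos i).le (num_nonneg (T.comp_mem (S.s_causal i).1 hmem))] at h
  exact (mul_eq_zero.1 (h i (Finset.mem_univ i))).resolve_left (S.p_pos i).ne'

/-- Some machine attains the optimal success probability, if the system has a spanning strategy. -/
theorem exists_success_eq_alpha {A : C} {U : BankStrategy T A} (hU : T.Spanning U)
    (S : BankStrategy T A) : ∃ χ ∈ T.machines A, T.success S χ = T.alpha S := by
  have := T.finiteDimensional A (A ⊗ A)
  -- Discarding the output in the average state of `U` is strictly positive on nonzero processes and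
  -- at most `1` on machines, which makes the set of machines compact.
  obtain ⟨χ, hχ, hχ', hmax⟩ := (T.cone A (A ⊗ A)).exists_forall_le_of_pos (T.isClosed_cone _ _)
    (T.pairing (T.average U) (T.disc (A ⊗ A))) (fun x hx h0 => hU.average_pos hx h0)
    (T.cone A (𝟙_ C)) (T.isClosed_cone _ _) (Linear.rightComp ℝ _ (T.disc (A ⊗ A))) (T.disc A)
    (T.disc_mem A) 1
    (fun x _ hx => (num_le_of_procLE hx (average_mem U)).trans_eq (num_average_disc U))
    (T.successₗ S)
  refine ⟨χ, ⟨hχ, hχ'⟩, le_antisymm (success_le_alpha S ⟨hχ, hχ'⟩) (alpha_le S fun y hy => ?_)⟩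
  rw [← successₗ_apply, ← successₗ_apply]
  exact hmax y hy.1 hy.2

/-! ### Making a strategy spanning -/

/-- Mixture of two strategies on the same system, with the effects of the second replaced by
discarding. -/
noncomputable def BankStrategy.mix {A : C} (S : BankStrategy T A) {m : ℕ} (t : Fin (m + 1) → (𝟙_ C ⟶ A))
    (ht : ∀ j, T.Causal (t j)) : BankStrategy T A where
  ι := S.ι ⊕ Fin (m + 1)
  fintype := inferInstance
  p := Sum.elim (fun i => S.p i / 2) (fun _ => 1 / (2 * (m + 1)))
  p_pos := by
    rintro (i | j)
    · exact half_pos (S.p_pos i)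
    · simp only [Sum.elim_inr]; positivity
  p_sum := by
    simp only [Fintype.sum_sum_type, Sum.elim_inl, Sum.elim_inr, ← Finset.sum_div, S.p_sum,
      Finset.sum_const, Finset.card_univ, Fintype.card_fin, nsmul_eq_mul, Nat.cast_add,
      Nat.cast_one]
    field_simp
    norm_num
  s := Sum.elim S.s t
  s_causal := by
    rintro (i | j)
    exacts [S.s_causal i, ht j]
  e := Sum.elim S.e fun _ => T.disc A
  e_mem := by
    rintro (i | j)
    exacts [S.e_mem i, T.disc_mem A]
  e_le := by
    rintro (i | j)
    · exact S.e_le i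
    · simp [ProcLE]
  accepts := by
    rintro (i | j)
    exacts [S.accepts i, (ht j).num_disc]

/-- The added states carry total weight `1/2`, so even if always passed they contribute at most
`1/2`. -/
theorem alpha_mix_le {A : C} (S : BankStrategy T A) {m : ℕ} (t : Fin (m + 1) → (𝟙_ C ⟶ A))
    (ht : ∀ j, T.Causal (t j)) : T.alpha (S.mix t ht) ≤ (T.alpha S + 1) / 2 := by
  refine alpha_le _ fun χ hχ => ?_
  have h1 := success_le_alpha S hχ
  have h2 : ∀ j, T.num (t j ≫ χ ≫ tensorEffect (T.disc A) (T.disc A)) ≤ 1 := fun j => by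
    rw [← disc_tensor']
    exact (num_le_of_procLE hχ.2 (ht j).1).trans_eq (ht j).num_disc
  have h3 : T.success (S.mix t ht) χ = T.success S χ / 2 +
      ∑ j, 1 / (2 * ((m : ℝ) + 1)) * T.num (t j ≫ χ ≫ tensorEffect (T.disc A) (T.disc A)) := by
    change ∑ k : S.ι ⊕ Fin (m + 1), _ = _
    rw [Fintype.sum_sum_type, success, Finset.sum_div]
    congr 1
    exact Finset.sum_congr rfl fun i _ => div_mul_eq_mul_div _ _ _
  have h4 : ∑ j, 1 / (2 * ((m : ℝ) + 1)) *
      T.num (t j ≫ χ ≫ tensorEffect (T.disc A) (T.disc A)) ≤ 1 / 2 := by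
    calc _ ≤ ∑ j : Fin (m + 1), 1 / (2 * ((m : ℝ) + 1)) * 1 :=
          Finset.sum_le_sum fun j _ => mul_le_mul_of_nonneg_left (h2 j) (by positivity)
      _ = 1 / 2 := by
          simp
          field_simp
  rw [h3]
  linarith

/-- Every strategy can be made spanning at the cost of halving its distance to `1`. -/
theorem exists_spanning_alpha_le {A : C} (S : BankStrategy T A) :
    ∃ S' : BankStrategy T A, T.Spanning S' ∧ T.alpha S' ≤ (T.alpha S + 1) / 2 := by
  have := T.finiteDimensional (𝟙_ C) A
  obtain ⟨f, hf, hspan, -⟩ :=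
    Submodule.exists_fun_fin_finrank_span_eq ℝ {s : 𝟙_ C ⟶ A | T.Causal s}
  have hne : Nonempty S.ι := by
    by_contra h
    rw [not_nonempty_iff] at h
    simpa using S.p_sum
  -- Prepending a state of `S` makes the family visibly nonempty, as `mix` requires.
  let t : Fin (Module.finrank ℝ (Submodule.span ℝ {s : 𝟙_ C ⟶ A | T.Causal s}) + 1) → _ :=
    Fin.cons (S.s hne.some) f
  have ht : ∀ j, T.Causal (t j) := Fin.cases (S.s_causal _) hf
  refine ⟨S.mix t ht, ?_, alpha_mix_le S t ht⟩
  refine eq_top_iff.2 ((hspan.trans (span_causal A)).ge.trans (Submodule.span_mono ?_))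
  rintro _ ⟨j, rfl⟩
  exact ⟨Sum.inr j.succ, rfl⟩

/-! ### Duality and physical dual states -/

/-- Strong duality for the counterfeiting problem: the success probability is dominated by a
functional of the output effect whose value on discarding is any number above the optimum. -/
theorem exists_dual {A : C} (S : BankStrategy T A) {β : ℝ} (hβ : T.alpha S ≤ β) :
    ∃ τ : (A ⟶ 𝟙_ C) →ₗ[ℝ] ℝ, τ (T.disc A) = β ∧
      ∀ χ ∈ T.cone A (A ⊗ A), T.success S χ ≤ τ (χ ≫ T.disc (A ⊗ A)) := by
  -- Pairs of an upper bound for the output effect and an upper bound for minus the success, jointly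
  -- realised by one process.
  let K : PointedCone ℝ ((A ⟶ 𝟙_ C) × ℝ) :=
    { carrier := {x | ∃ χ ∈ T.cone A (A ⊗ A), T.ProcLE (χ ≫ T.disc (A ⊗ A)) x.1 ∧
        -T.success S χ ≤ x.2}
      zero_mem' := ⟨0, zero_mem _, by simp [ProcLE], by simp [← successₗ_apply]⟩
      add_mem' := by
        rintro x y ⟨χ, hχ, h1, h2⟩ ⟨ψ, hψ, h3, h4⟩
        refine ⟨χ + ψ, add_mem hχ hψ, ?_, ?_⟩
        · have := add_mem h1 h3
          rwa [sub_add_sub_comm, ← Preadditive.add_comp] at this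
        · rw [← successₗ_apply] at h2 h4 ⊢
          rw [map_add, Prod.snd_add]
          linarith
      smul_mem' := by
        rintro ⟨c, hc⟩ x ⟨χ, hχ, h1, h2⟩
        refine ⟨c • χ, smul_mem_cone hχ hc, ?_, ?_⟩
        · have := smul_mem_cone h1 hc
          rwa [smul_sub, ← Linear.smul_comp] at this
        · rw [← successₗ_apply] at h2 ⊢
          rw [map_smul, smul_eq_mul, ← mul_neg]
          exact mul_le_mul_of_nonneg_left h2 hc }
  -- Only the values on `D` matter; the average state merely serves to read off the coefficient of
  -- discarding.
  let f₀ : (A ⟶ 𝟙_ C) × ℝ →ₗ[ℝ] ℝ :=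
    β • (T.evalState A (T.average S) ∘ₗ LinearMap.fst ℝ _ _) + LinearMap.snd ℝ _ _
  let D : Submodule ℝ ((A ⟶ 𝟙_ C) × ℝ) := (Submodule.span ℝ {T.disc A}).prod ⊤
  have hf₀ : ∀ a b : ℝ, f₀ (a • T.disc A, b) = β * a + b := by
    intro a b
    simp [f₀, num_average_disc]
  obtain ⟨g, hg, hgK⟩ := riesz_extension K ⟨D, f₀.domRestrict D⟩ (by
      rintro ⟨⟨e, b⟩, he, hb⟩
      obtain ⟨a, rfl⟩ : ∃ a : ℝ, a • T.disc A = e := Submodule.mem_span_singleton.1 he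
      intro hK
      obtain ⟨χ, hχ, h1, h2⟩ : ∃ χ ∈ T.cone A (A ⊗ A),
        T.ProcLE (χ ≫ T.disc (A ⊗ A)) (a • T.disc A) ∧ -T.success S χ ≤ b := hK
      change 0 ≤ f₀ (a • T.disc A, b)
      rw [hf₀]
      have h3 := num_le_of_procLE h1 (average_mem S)
      have h4 := success_le_average S hχ
      have h5 := success_nonneg S hχ
      simp only [Linear.comp_smul, map_smul, num_average_disc, smul_eq_mul, mul_one] at h3
      -- For `a = 0` the success vanishes; for `a > 0` rescaling bounds it by `a * T.alpha S`.
      rcases (h5.trans (h4.trans h3)).eq_or_lt with ha | ha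
      · rw [← ha]; linarith
      · have := success_le_mul_alpha S ha hχ h1
        nlinarith) (by
      rintro ⟨e, y⟩
      -- The extension condition follows from the order unit, with the zero process as witness; `K`
      -- need not be closed.
      obtain ⟨c, hc, h⟩ := (T.cone A (𝟙_ C)).exists_smul_add_mem (T.disc_mem_interior A) e
      refine ⟨⟨(c • T.disc A, -y), Submodule.smul_mem _ _ (Submodule.subset_span rfl), trivial⟩,
        0, zero_mem _, ?_, ?_⟩
      · simpa [ProcLE] using h
      · simp [← successₗ_apply])
  have hgD : ∀ a b : ℝ, g (a • T.disc A, b) = β * a + b := fun a b => by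
    rw [← hf₀]
    exact hg ⟨(a • T.disc A, b), Submodule.smul_mem _ _ (Submodule.subset_span rfl), trivial⟩
  refine ⟨g ∘ₗ LinearMap.inl ℝ _ _, ?_, fun χ hχ => ?_⟩
  · have := hgD 1 0
    simpa using this
  · have h1 := hgK (χ ≫ T.disc (A ⊗ A), -T.success S χ) ⟨χ, hχ, by simp [ProcLE], le_rfl⟩
    have h2 := hgD 0 (-T.success S χ)
    have h3 : g (χ ≫ T.disc (A ⊗ A), -T.success S χ) = g (χ ≫ T.disc (A ⊗ A), 0) +
        g ((0 : ℝ) • T.disc A, -T.success S χ) := by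
      rw [← map_add]; simp
    rw [h3, h2] at h1
    simp only [LinearMap.comp_apply, LinearMap.inl_apply]
    linarith

/-- For a spanning strategy that cannot be counterfeited perfectly, the dominating functional can
be chosen to be a physical state. -/
theorem Spanning.exists_state_dual {A : C} {S : BankStrategy T A} (hS : T.Spanning S)
    (hα : T.alpha S < 1) : ∃ τ ∈ T.cone (𝟙_ C) A,
      0 < T.num (τ ≫ T.disc A) ∧ T.num (τ ≫ T.disc A) < 1 ∧
      ∀ χ ∈ T.cone A (A ⊗ A), T.success S χ ≤ T.num (τ ≫ χ ≫ T.disc (A ⊗ A)) := by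
  have := T.finiteDimensional A (𝟙_ C)
  obtain ⟨β, hβ, hβ1⟩ := exists_between (max_lt hα one_pos)
  obtain ⟨φ, hφd, hφ⟩ := exists_dual S ((le_max_left _ _).trans hβ.le)
  -- The states of `S` separate effects, so their evaluations span the dual space. The coefficients
  -- `c i` may be negative.
  have hspan : φ ∈ Submodule.span ℝ (Set.range fun i => T.evalState A (S.s i)) := by
    refine FiniteDimensional.mem_span_of_iInf_ker_le_ker fun e he => ?_
    have : e = 0 := hS.effect_eq_zero fun i => by
      simpa using (Submodule.mem_iInf _).1 he i
    simp [this]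
  obtain ⟨c, hc⟩ := (Submodule.mem_span_range_iff_exists_fun ℝ).1 hspan
  -- Since every `S.p i` is positive, a small step from the average state towards `φ` stays in the
  -- cone. Domination is convex, and the norm becomes `(1 - ε) + ε * β < 1`.
  obtain ⟨ε, hε, hε1, hpos⟩ : ∃ ε : ℝ, 0 < ε ∧ ε < 1 ∧
      ∀ i, 0 ≤ (1 - ε) * S.p i + ε * c i := by
    have h : ∀ᶠ ε : ℝ in nhdsWithin 0 (Set.Ioi 0), ∀ i, 0 < (1 - ε) * S.p i + ε * c i := by
      rw [Filter.eventually_all]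
      intro i
      have hcont : Continuous fun ε : ℝ => (1 - ε) * S.p i + ε * c i := by fun_prop
      exact nhdsWithin_le_nhds <| hcont.continuousAt.eventually
        (lt_mem_nhds (by simpa using S.p_pos i))
    obtain ⟨ε, hε, hε'⟩ := (h.and (Ioo_mem_nhdsGT one_pos)).exists
    exact ⟨ε, hε'.1, hε'.2, fun i => (hε i).le⟩
  set τ : 𝟙_ C ⟶ A := ∑ i, ((1 - ε) * S.p i + ε * c i) • S.s i with hτ
  have hval : ∀ e, T.num (τ ≫ e) = (1 - ε) * T.num (T.average S ≫ e) + ε * φ e := by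
    intro e
    rw [← hc, num_average_comp]
    simp only [hτ, Preadditive.sum_comp, Linear.smul_comp, map_sum, map_smul, smul_eq_mul,
      LinearMap.sum_apply, LinearMap.smul_apply, evalState_apply, Finset.mul_sum,
      ← Finset.sum_add_distrib]
    exact Finset.sum_congr rfl fun i _ => by ring
  have hβ0 : 0 < β := (le_max_right _ _).trans_lt hβ
  refine ⟨τ, Submodule.sum_mem _ fun i _ => smul_mem_cone (S.s_causal i).1 (hpos i), ?_, ?_, ?_⟩
  · rw [hval, num_average_disc, hφd]
    nlinarith
  · rw [hval, num_average_disc, hφd]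
    nlinarith
  · intro χ hχ
    rw [hval]
    have h1 := success_le_average S hχ
    have h2 := hφ χ hχ
    nlinarith

/-! ### Exponential security and the dichotomy -/

/-- A spanning strategy that cannot be counterfeited perfectly is exponentially secure. -/
theorem Spanning.exponentiallySecure {A : C} {S : BankStrategy T A} (hS : T.Spanning S)
    (hα : T.alpha S < 1) : T.ExponentiallySecure S := by
  obtain ⟨τ, hτ, h0, h1, hdom⟩ := hS.exists_state_dual hα
  refine ⟨_, h0, h1, fun n => ?_⟩
  induction n with
  | zero => simpa using alpha_le_one (S.rep 0)
  | succ n ih =>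
    rw [pow_succ']
    exact (alpha_prod_le S (S.rep n) hτ h0 hdom).trans (mul_le_mul_of_nonneg_left ih h0.le)

theorem ExponentiallySecure.exists_alpha_le {A : C} {S : BankStrategy T A}
    (hS : T.ExponentiallySecure S) {δ : ℝ} (hδ : 0 < δ) :
    ∃ n : ℕ, 1 ≤ n ∧ T.alpha (S.rep n) ≤ δ := by
  obtain ⟨r, h0, h1, h⟩ := hS
  obtain ⟨n, hn⟩ := exists_pow_lt_of_lt_one hδ h1
  -- The shift by one only guarantees a positive number of repetitions.
  refine ⟨n + 1, Nat.le_add_left 1 n, (h _).trans (le_trans ?_ hn.le)⟩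
  exact pow_le_pow_of_le_one h0.le h1.le n.le_succ

theorem exists_spanning_exponentiallySecure {A : C} (S' : BankStrategy T A)
    (h : T.alpha S' < 1) :
    ∃ S : BankStrategy T A, T.Spanning S ∧ T.alpha S < 1 ∧ T.ExponentiallySecure S := by
  obtain ⟨S, hS, hα⟩ := exists_spanning_alpha_le S'
  have hα : T.alpha S < 1 := by linarith
  exact ⟨S, hS, hα, hS.exponentiallySecure hα⟩

theorem perfectCounterfeiting_of_not_wnc (h : ¬ T.WNC) : T.PerfectCounterfeiting := by
  intro A S
  have h1 : T.alpha S = 1 :=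
    (alpha_le_one S).antisymm (not_lt.1 fun hlt => h ⟨A, S, hlt⟩)
  -- `U` is needed only for compactness of the machines; its own `alpha` plays no role.
  obtain ⟨U, hU, -⟩ := exists_spanning_alpha_le S
  obtain ⟨χ, hχ, hs⟩ := exists_success_eq_alpha hU S
  exact ⟨h1, χ, hχ, hs.trans h1⟩

end GPT

theorem mainTheorem1 {C : Type u} [Category.{v} C] [MonoidalCategory C] [SymmetricCategory C]
    [Preadditive C] [Linear ℝ C] [MonoidalPreadditive C] [MonoidalLinear ℝ C] (T : GPT C) :
    (T.WNC ↔ T.SNC) ∧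
    (∀ (A : C) (S' : GPT.BankStrategy T A), T.alpha S' < 1 →
      ∃ S : GPT.BankStrategy T A, T.Spanning S ∧ T.alpha S < 1 ∧ T.ExponentiallySecure S ∧
        ∀ δ : ℝ, 0 < δ → ∃ n : ℕ, 1 ≤ n ∧ T.alpha (S.rep n) ≤ δ) ∧
    Xor T.PerfectCounterfeiting
      (∃ (A : C) (S : GPT.BankStrategy T A), T.Spanning S ∧ T.ExponentiallySecure S) := by
  refine ⟨⟨?_, ?_⟩, ?_, ?_⟩
  · rintro ⟨A, S', h⟩ δ hδ
    obtain ⟨S, -, -, hS⟩ := GPT.exists_spanning_exponentiallySecure S' h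
    obtain ⟨n, -, hn⟩ := hS.exists_alpha_le hδ
    exact ⟨_, S.rep n, hn⟩
  · intro h
    obtain ⟨A, S, hS⟩ := h (1 / 2) (by norm_num)
    exact ⟨A, S, hS.trans_lt (by norm_num)⟩
  · intro A S' h
    obtain ⟨S, hspan, hα, hS⟩ := GPT.exists_spanning_exponentiallySecure S' h
    exact ⟨S, hspan, hα, hS, fun δ hδ => hS.exists_alpha_le hδ⟩
  · rw [xor_iff_or_and_not_and]
    constructor
    · by_cases hW : T.WNC
      · obtain ⟨A, S', h⟩ := hW
        obtain ⟨S, hspan, -, hS⟩ := GPT.exists_spanning_exponentiallySecure S' h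
        exact Or.inr ⟨A, S, hspan, hS⟩
      · exact Or.inl (GPT.perfectCounterfeiting_of_not_wnc hW)
    · rintro ⟨hP, A, S, -, r, -, hr1, hr⟩
      -- A single repetition already contradicts perfect counterfeiting: it would give `1 ≤ r`.
      have h1 := hr 1
      rw [(hP _ (S.rep 1)).1, pow_one] at h1
      exact hr1.not_ge h1
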